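/- Let $X$ be a real Hilbert space, let $m>1$, let $\mathbf\Omega=\{\Omega_1,\dots,\Omega_m\}$ be a collection of closed subsets of $X$, and let $\bar x\in\bigcap_{i=1}^m\Omega_i$. For a normed space $Y$ write $\mathbb B$ for its closed unit ball and $B_\delta(y)$ for the closed ball of radius $\delta$ and centre $y$. The collection $\mathbf\Omega$ is called \emph{uniformly regular} at $\bar x$ if there exist $\delta,\alpha>0$ such that $$\bigcap_{i=1}^m(\Omega_i-\omega_i-a_i)\cap(\rho\mathbb B)\neq\emptyset$$ for all $\rho\in(0,\delta]$, $\omega_i\in\Omega_i\cap B_\delta(\bar x)$ and $a_i\in(\alpha\rho)\mathbb B$, $i=1,\dots,m$. For a subset $S$ of a normed space $Y$, a point $\bar y\in S$ and $\delta\ge 0$, let $$N_S(\bar y)=\Big\{y^*\in Y^*\;\Big|\;\limsup_{y\to\bar y,\;y\in S,\;y\ne\bar y}\frac{\langle y^*,y-\bar y\rangle}{\|y-\bar y\|}\le 0\Big\},\qquad \widehat N_S(\bar y,\delta)=\bigcup_{y\in S\cap B_\delta(\bar y)}N_S(y).$$ For a pair $\mathbf S=\{S_1,S_2\}$ of subsets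 of $Y$ and $\bar y\in S_1\cap S_2$ put $$\hat\eta[\mathbf S](\bar y)=\lim_{\delta\downarrow0}\inf\big\{\|y_1^*+y_2^*\|\;\big|\;y_i^*\in\widehat N_{S_i}(\bar y,\delta)\ (i=1,2),\ \|y_1^*\|+\|y_2^*\|=1\big\},$$ $$\hat\nu[\mathbf S](\bar y)=\lim_{\delta\downarrow0}\sup\big\{\|y_1^*-y_2^*\|\;\big|\;y_i^*\in\widehat N_{S_i}(\bar y,\delta),\ \|y_i^*\|=\tfrac12\ (i=1,2)\big\},$$ $$\hat c[\mathbf S](\bar y)=1-2\big(\hat\eta[\mathbf S](\bar y)\big)^2,$$ where the infimum over the empty set is taken to be $1$ and the supremum over the empty set to be $0$. Equip $X^m$ with the norm $\|(x_1,\dots,x_m)\|=\big(\sum_{i=1}^m\|x_i\|^2\big)^{1/2}$ and let $$\Omega=\Omega_1\times\dots\times\Omega_m,\qquad L=\{(x,\dots,x)\mid x\in X\},\qquad \mathbf\Omega'=\{\Omega,L\},\qquad \bar z=(\bar x,\dots,\bar x)\in\Omega\cap L.$$ Then $\mathbf\Omega$ is uniformly regular at $\bar x$ if and only if any one of the following conditions,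 which are equivalent to each other, holds: (i) $\hat\eta[\mathbf\Omega'](\bar z)>0$; (ii) $\hat\nu[\mathbf\Omega'](\bar z)<1$; (iii) $\hat c[\mathbf\Omega'](\bar z)<1$. -/

import Mathlib

open Filter Topology

noncomputable section

namespace SetRegularity

section Normed

variable {X : Type*} [NormedAddCommGroup X] [NormedSpace ℝ X]

/-- Uniform regularity of a finite collection `Ω` of sets at `xbar`: there are `δ, α > 0` such that
`⋂ i, (Ω i - ω i - a i)` meets `ρ 𝔹` for all `ρ ∈ (0, δ]`, `ω i ∈ Ω i ∩ B_δ(xbar)` and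
`a i ∈ (α ρ) 𝔹`. All balls are closed. -/
def UniformlyRegular {ι : Type*} (Ω : ι → Set X) (xbar : X) : Prop :=
  ∃ δ > (0 : ℝ), ∃ α > (0 : ℝ), ∀ ρ ∈ Set.Ioc (0 : ℝ) δ, ∀ ω a : ι → X,
    (∀ i, ω i ∈ Ω i ∩ Metric.closedBall xbar δ) →
    (∀ i, a i ∈ Metric.closedBall (0 : X) (α * ρ)) →
    ((⋂ i, (fun x => x - ω i - a i) '' Ω i) ∩ Metric.closedBall (0 : X) ρ).Nonempty

/-- The Fréchet normal cone to `Ω` at `x`: the functionals `x*` in the topological dual with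
`limsup ⟨x*, u - x⟩ / ‖u - x‖ ≤ 0` as `u → x`, `u ∈ Ω`, the inequality being written out with `ε`
and without the division. It is used at points `x ∈ Ω` only. -/
def frechetNormalCone (Ω : Set X) (x : X) : Set (StrongDual ℝ X) :=
  {f | ∀ ε > (0 : ℝ), ∀ᶠ u in 𝓝[Ω] x, f (u - x) ≤ ε * ‖u - x‖}

/-- The strict `δ`-normal cone to `Ω` at `xbar`: the union of the Fréchet normal cones to `Ω` at the
points of `Ω ∩ B_δ(xbar)`. -/
def strictNormalCone (Ω : Set X) (xbar : X) (δ : ℝ) : Set (StrongDual ℝ X) :=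
  ⋃ x ∈ Ω ∩ Metric.closedBall xbar δ, frechetNormalCone Ω x

theorem strictNormalCone_mono (Ω : Set X) (xbar : X) {δ δ' : ℝ} (h : δ ≤ δ') :
    strictNormalCone Ω xbar δ ⊆ strictNormalCone Ω xbar δ' :=
  Set.biUnion_subset_biUnion_left
    (Set.inter_subset_inter_right _ (Metric.closedBall_subset_closedBall h))

/-- The norms `‖∑ i, x*_i‖` with `x*_i` in the strict `δ`-normal cone to `Ω i` at `xbar` and
`∑ i, ‖x*_i‖ = 1`. -/
def etaSet {ι : Type*} [Fintype ι] (Ω : ι → Set X) (xbar : X) (δ : ℝ) : Set ℝ :=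
  {r | ∃ f : ι → StrongDual ℝ X, (∀ i, f i ∈ strictNormalCone (Ω i) xbar δ) ∧
    ∑ i, ‖f i‖ = 1 ∧ r = ‖∑ i, f i‖}

open Classical in
/-- The infimum of `etaSet`, the infimum over the empty set being `1`. -/
def etaInf {ι : Type*} [Fintype ι] (Ω : ι → Set X) (xbar : X) (δ : ℝ) : ℝ :=
  if (etaSet Ω xbar δ).Nonempty then sInf (etaSet Ω xbar δ) else 1

/-- The dual constant `η̂[Ω](xbar)`, the limit of `etaInf` as `δ ↓ 0`. The limit exists, see
`tendsto_etaInf`. -/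
def etaHat {ι : Type*} [Fintype ι] (Ω : ι → Set X) (xbar : X) : ℝ :=
  limUnder (𝓝[>] (0 : ℝ)) (etaInf Ω xbar)

/-- The constant `ĉ[Ω](xbar) = 1 - 2 η̂[Ω](xbar)²`. -/
def cHat {ι : Type*} [Fintype ι] (Ω : ι → Set X) (xbar : X) : ℝ :=
  1 - 2 * etaHat Ω xbar ^ 2

/-- The norms `‖x*_1 - x*_2‖` with `x*_i` in the strict `δ`-normal cone to `Ω i` at `xbar` and
`‖x*_i‖ = 1/2`, for a pair of sets. -/
def nuSet (Ω : Fin 2 → Set X) (xbar : X) (δ : ℝ) : Set ℝ :=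
  {r | ∃ f : Fin 2 → StrongDual ℝ X, (∀ i, f i ∈ strictNormalCone (Ω i) xbar δ) ∧
    (∀ i, ‖f i‖ = 1 / 2) ∧ r = ‖f 0 - f 1‖}

open Classical in
/-- The supremum of `nuSet`, the supremum over the empty set being `0`. -/
def nuSup (Ω : Fin 2 → Set X) (xbar : X) (δ : ℝ) : ℝ :=
  if (nuSet Ω xbar δ).Nonempty then sSup (nuSet Ω xbar δ) else 0

/-- The constant `ν̂[Ω](xbar)` of a pair of sets, the limit of `nuSup` as `δ ↓ 0`. The limit exists,
see `tendsto_nuSup`. -/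
def nuHat (Ω : Fin 2 → Set X) (xbar : X) : ℝ :=
  limUnder (𝓝[>] (0 : ℝ)) (nuSup Ω xbar)

theorem etaSet_mono {ι : Type*} [Fintype ι] (Ω : ι → Set X) (xbar : X) {δ δ' : ℝ} (h : δ ≤ δ') :
    etaSet Ω xbar δ ⊆ etaSet Ω xbar δ' := by
  rintro r ⟨f, hf, h1, h2⟩
  exact ⟨f, fun i => strictNormalCone_mono _ _ h (hf i), h1, h2⟩

theorem etaSet_subset {ι : Type*} [Fintype ι] (Ω : ι → Set X) (xbar : X) (δ : ℝ) :
    etaSet Ω xbar δ ⊆ Set.Icc 0 1 := by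
  rintro r ⟨f, hf, h1, rfl⟩
  exact ⟨norm_nonneg _, h1 ▸ norm_sum_le _ _⟩

theorem etaInf_antitone {ι : Type*} [Fintype ι] (Ω : ι → Set X) (xbar : X) :
    Antitone (etaInf Ω xbar) := by
  intro δ δ' h
  have hb : BddBelow (etaSet Ω xbar δ') := ⟨0, fun r hr => (etaSet_subset Ω xbar δ' hr).1⟩
  unfold etaInf
  by_cases h1 : (etaSet Ω xbar δ).Nonempty
  · rw [if_pos h1, if_pos (h1.mono (etaSet_mono Ω xbar h))]
    exact csInf_le_csInf hb h1 (etaSet_mono Ω xbar h)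
  · rw [if_neg h1]
    split_ifs with h2
    · obtain ⟨r, hr⟩ := h2
      exact (csInf_le hb hr).trans (etaSet_subset Ω xbar δ' hr).2
    · exact le_rfl

theorem tendsto_etaInf {ι : Type*} [Fintype ι] (Ω : ι → Set X) (xbar : X) :
    Tendsto (etaInf Ω xbar) (𝓝[>] (0 : ℝ)) (𝓝 (etaHat Ω xbar)) := by
  have hm : Monotone (fun δ => - etaInf Ω xbar δ) := (etaInf_antitone Ω xbar).neg
  have h := (hm.tendsto_nhdsGT 0).neg
  simp only [neg_neg] at h
  exact tendsto_nhds_limUnder ⟨_, h⟩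

theorem nuSet_mono (Ω : Fin 2 → Set X) (xbar : X) {δ δ' : ℝ} (h : δ ≤ δ') :
    nuSet Ω xbar δ ⊆ nuSet Ω xbar δ' := by
  rintro r ⟨f, hf, h1, h2⟩
  exact ⟨f, fun i => strictNormalCone_mono _ _ h (hf i), h1, h2⟩

theorem nuSet_subset (Ω : Fin 2 → Set X) (xbar : X) (δ : ℝ) :
    nuSet Ω xbar δ ⊆ Set.Icc 0 1 := by
  rintro r ⟨f, hf, h1, rfl⟩
  refine ⟨norm_nonneg _, (norm_sub_le _ _).trans ?_⟩
  rw [h1, h1]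
  norm_num

theorem nuSup_monotone (Ω : Fin 2 → Set X) (xbar : X) : Monotone (nuSup Ω xbar) := by
  intro δ δ' h
  have hb : BddAbove (nuSet Ω xbar δ') := ⟨1, fun r hr => (nuSet_subset Ω xbar δ' hr).2⟩
  unfold nuSup
  by_cases h1 : (nuSet Ω xbar δ).Nonempty
  · rw [if_pos h1, if_pos (h1.mono (nuSet_mono Ω xbar h))]
    exact csSup_le_csSup hb h1 (nuSet_mono Ω xbar h)
  · rw [if_neg h1]
    split_ifs with h2
    · obtain ⟨r, hr⟩ := h2
      exact (nuSet_subset Ω xbar δ' hr).1.trans (le_csSup hb hr)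
    · exact le_rfl

theorem tendsto_nuSup (Ω : Fin 2 → Set X) (xbar : X) :
    Tendsto (nuSup Ω xbar) (𝓝[>] (0 : ℝ)) (𝓝 (nuHat Ω xbar)) :=
  tendsto_nhds_limUnder ⟨_, (nuSup_monotone Ω xbar).tendsto_nhdsGT 0⟩

end Normed

section Product

variable {X : Type*} {m : ℕ}

/-- The diagonal point `A x = (x, …, x)` of `X ^ m`, the latter with the norm
`‖(x_1, …, x_m)‖ = (∑ i, ‖x_i‖ ^ 2) ^ (1/2)`. -/
def diagPoint (m : ℕ) (x : X) : PiLp 2 (fun _ : Fin m => X) :=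
  WithLp.toLp 2 (fun _ => x)

/-- The pair of sets `{Ω_1 × ⋯ × Ω_m, L}` in `X ^ m`, where `L = {(x, …, x) | x ∈ X}`. -/
def productPair (Ω : Fin m → Set X) : Fin 2 → Set (PiLp 2 (fun _ : Fin m => X)) :=
  ![{z | ∀ i, z i ∈ Ω i}, Set.range (diagPoint m)]

end Product

end SetRegularity

end

noncomputable section

namespace SetRegularity

open Filter Topology
open scoped RealInnerProductSpace

/-! Up to factors `√m`, uniform regularity says that small translates of the product set C still
meet the diagonal L near the origin, at a linear rate (`RegularAlong`). This is equivalent to an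
angle condition: normals v to C near the point satisfy c‖v‖ ≤ ‖P_L v‖ (`DuallyRegularAlong`). If
regularity holds, translating C along v and testing the normal inequality gives the bound.
Conversely, nearly minimize the distance to a translate of L over C by
`smooth_variational_principle`: at a positive minimum, a small perturbation of a unit vector of Lᗮ
is a normal, which the angle condition forbids.

Normals to L form Lᗮ, and ‖v + g‖ over g ∈ Lᗮ is least, equal to ‖P_L v‖, at g = -P_{Lᗮ} v. Hence
the angle condition is η̂ > 0. The parallelogram law turns η̂ > 0 into ν̂ < 1, and ĉ < 1 follows
from η̂ ≥ 0. -/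

/-! ### Variational principle with quadratic perturbations. -/

theorem exists_approx_minimizer {α : Type*} {C : Set α} {g : α → ℝ} (hg : ∀ y ∈ C, 0 ≤ g y)
    {z : α} (hz : z ∈ C) {ε : ℝ} (hε : 0 < ε) :
    ∃ z' ∈ C, g z' ≤ g z ∧ ∀ y ∈ C, g z' ≤ g y + ε := by
  have hb : BddBelow (g '' C) := ⟨0, by rintro _ ⟨y, hy, rfl⟩; exact hg y hy⟩
  have hinf : ∀ y ∈ C, sInf (g '' C) ≤ g y := fun y hy => csInf_le hb ⟨y, hy, rfl⟩
  by_cases h : g z ≤ sInf (g '' C) + ε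
  · exact ⟨z, hz, le_rfl, fun y hy => by linarith [hinf y hy]⟩
  · obtain ⟨_, ⟨z', hz', rfl⟩, hlt⟩ :=
      exists_lt_of_csInf_lt (Set.Nonempty.image g ⟨z, hz⟩) (lt_add_of_pos_right _ hε)
    exact ⟨z', hz', by linarith, fun y hy => by linarith [hinf y hy]⟩

/-- A sequence of approximate minimizers of `f + ∑ k < n, κ k * ‖· - z k‖ ^ 2` over `C`. -/
theorem exists_perturbed_minimizing_sequence {H : Type*} [NormedAddCommGroup H]
    {C : Set H} {f : H → ℝ} (hf : ∀ y ∈ C, 0 ≤ f y)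
    {κ ε : ℕ → ℝ} (hκ : ∀ n, 0 ≤ κ n) (hε : ∀ n, 0 < ε n) {z₀ : H} (hz₀ : z₀ ∈ C)
    (h₀ : f z₀ ≤ ε 0) :
    ∃ z : ℕ → H, z 0 = z₀ ∧ (∀ n, z n ∈ C) ∧
      (∀ n, f (z (n + 1)) + ∑ k ∈ Finset.range (n + 1), κ k * ‖z (n + 1) - z k‖ ^ 2 ≤
        f (z n) + ∑ k ∈ Finset.range n, κ k * ‖z n - z k‖ ^ 2) ∧
      ∀ n, ∀ y ∈ C, f (z n) + ∑ k ∈ Finset.range n, κ k * ‖z n - z k‖ ^ 2 ≤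
        f y + ∑ k ∈ Finset.range n, κ k * ‖y - z k‖ ^ 2 + ε n := by
  -- The hypotheses sit under the existential so that `choose` yields a total function, usable in a
  -- recursion.
  have hsel : ∀ (g : H → ℝ) (z : H) (e : ℝ), ∃ z', (∀ y ∈ C, 0 ≤ g y) → z ∈ C → 0 < e →
      z' ∈ C ∧ g z' ≤ g z ∧ ∀ y ∈ C, g z' ≤ g y + e := by
    intro g z e
    by_cases h : (∀ y ∈ C, 0 ≤ g y) ∧ z ∈ C ∧ 0 < e
    · obtain ⟨z', h1, h2, h3⟩ := exists_approx_minimizer h.1 h.2.1 h.2.2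
      exact ⟨z', fun _ _ _ => ⟨h1, h2, h3⟩⟩
    · exact ⟨z, fun h1 h2 h3 => absurd ⟨h1, h2, h3⟩ h⟩
  choose pick hpick using hsel
  let next : ℕ → (H → ℝ) × H → (H → ℝ) := fun n p y => p.1 y + κ n * ‖y - p.2‖ ^ 2
  let st : ℕ → (H → ℝ) × H := fun n =>
    Nat.rec (f, z₀) (fun n p => (next n p, pick (next n p) p.2 (ε (n + 1)))) n
  have st_succ : ∀ n, st (n + 1) =
      (next n (st n), pick (next n (st n)) (st n).2 (ε (n + 1))) := fun n => rfl
  have inv : ∀ n, (∀ y ∈ C, 0 ≤ (st n).1 y) ∧ (st n).2 ∈ C := by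
    intro n
    induction n with
    | zero => exact ⟨hf, hz₀⟩
    | succ n ih =>
      have h1 : ∀ y ∈ C, 0 ≤ next n (st n) y := fun y hy =>
        add_nonneg (ih.1 y hy) (mul_nonneg (hκ n) (sq_nonneg _))
      rw [st_succ]
      exact ⟨h1, (hpick _ _ _ h1 ih.2 (hε _)).1⟩
  have hfun : ∀ n y, (st n).1 y = f y + ∑ k ∈ Finset.range n, κ k * ‖y - (st k).2‖ ^ 2 := by
    intro n
    induction n with
    | zero => intro y; simp [st]
    | succ n ih =>
      intro y
      rw [st_succ, Finset.sum_range_succ, ← add_assoc, ← ih]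
  have hstep : ∀ n, (st (n + 1)).1 (st (n + 1)).2 ≤ (st (n + 1)).1 (st n).2 ∧
      ∀ y ∈ C, (st (n + 1)).1 (st (n + 1)).2 ≤ (st (n + 1)).1 y + ε (n + 1) := by
    intro n
    have h1 : ∀ y ∈ C, 0 ≤ next n (st n) y := (inv (n + 1)).1
    exact (hpick _ _ _ h1 (inv n).2 (hε (n + 1))).2
  have st_zero : st 0 = (f, z₀) := rfl
  clear_value st
  refine ⟨fun n => (st n).2, by simp only [st_zero], fun n => (inv n).2, fun n => ?_,
    fun n y hy => ?_⟩
  -- The newly added penalty is centred at z n, so it vanishes there.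
  · have h := (hstep n).1
    rw [hfun, hfun] at h
    rwa [Finset.sum_range_succ (fun k => κ k * ‖(st n).2 - (st k).2‖ ^ 2), sub_self, norm_zero,
      zero_pow two_ne_zero, mul_zero, add_zero] at h
  · cases n with
    | zero => simpa [st_zero] using h₀.trans (le_add_of_nonneg_left (hf y hy))
    | succ n =>
      have h := (hstep n).2 y hy
      rwa [hfun, hfun] at h

section Hilbert

variable {H : Type*} [NormedAddCommGroup H] [InnerProductSpace ℝ H]

theorem norm_sub_sq_sub_norm_sub_sq (z y w : H) :
    ‖z - w‖ ^ 2 - ‖y - w‖ ^ 2 = 2 * ⟪y - w, z - y⟫ + ‖z - y‖ ^ 2 := by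
  have h : z - w = (y - w) + (z - y) := by abel
  rw [h, norm_add_sq_real]
  ring

/-- A smooth variational principle with quadratic perturbations in a Hilbert space. -/
theorem smooth_variational_principle [CompleteSpace H] {C : Set H} (hC : IsClosed C) {f : H → ℝ}
    (hcont : Continuous f) (hf : ∀ y ∈ C, 0 ≤ f y) {κ r : ℝ} (hκ : 0 < κ) (hr : 0 < r) {z₀ : H}
    (hz₀ : z₀ ∈ C) (h₀ : f z₀ ≤ κ * r ^ 2 / 8) :
    ∃ y ∈ C, ∃ q : H, ‖y - z₀‖ ≤ r ∧ ‖q‖ ≤ 2 * κ * r ∧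
      ∀ z ∈ C, f y ≤ f z + ⟪q, z - y⟫ + κ * ‖z - y‖ ^ 2 := by
  -- The weights sum to κ; ε n makes the n-th step at most r / 2 / 2 ^ n, with total r, and ε 0 = κ
  -- r² / 8 is the bound on f z₀.
  let κ' : ℕ → ℝ := fun n => κ / 2 / 2 ^ n
  let ε : ℕ → ℝ := fun n => κ' n * (r / 2 / 2 ^ n) ^ 2
  have hκ' : ∀ n, 0 < κ' n := fun n => by positivity
  have hε : ∀ n, 0 < ε n := fun n => mul_pos (hκ' n) (by positivity)
  obtain ⟨z, hz0, hzC, hdec, hmin⟩ := exists_perturbed_minimizing_sequence hf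
    (fun n => (hκ' n).le) hε hz₀ (h₀.trans (le_of_eq (by simp only [ε, κ']; ring)))
  have hdist : ∀ n, dist (z n) (z (n + 1)) ≤ r / 2 / 2 ^ n := by
    intro n
    have h := (hdec n).trans (hmin n _ (hzC (n + 1)))
    rw [Finset.sum_range_succ] at h
    have h2 : κ' n * ‖z (n + 1) - z n‖ ^ 2 ≤ κ' n * (r / 2 / 2 ^ n) ^ 2 := by
      change _ ≤ ε n
      linarith
    rw [dist_comm, dist_eq_norm]
    exact le_of_sq_le_sq (le_of_mul_le_mul_left h2 (hκ' n)) (by positivity)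
  obtain ⟨y, hy⟩ := cauchySeq_tendsto_of_complete (cauchySeq_of_le_geometric_two hdist)
  have hyz : ∀ n, ‖y - z n‖ ≤ r := by
    intro n
    rw [← dist_eq_norm, dist_comm]
    refine (dist_le_of_le_geometric_two_of_tendsto hdist hy n).trans ?_
    exact div_le_self hr.le (one_le_pow₀ one_le_two)
  have hyC : y ∈ C := hC.mem_of_tendsto hy (Eventually.of_forall hzC)
  have hsum : HasSum κ' κ := hasSum_geometric_two' κ
  have hbound : ∀ n, ‖(2 * κ' n) • (y - z n)‖ ≤ 2 * r * κ' n := by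
    intro n
    rw [norm_smul, Real.norm_of_nonneg (by linarith [hκ' n])]
    nlinarith [hyz n, hκ' n]
  have hsummable : Summable fun n => (2 * κ' n) • (y - z n) :=
    Summable.of_norm_bounded (hsum.summable.mul_left (2 * r)) hbound
  -- q is the gradient at y of the limiting penalty; expanding the squares about y leaves exactly
  -- ⟪q, w - y⟫ + κ‖w - y‖².
  refine ⟨y, hyC, ∑' n, (2 * κ' n) • (y - z n), hz0 ▸ hyz 0, ?_, fun w hw => ?_⟩
  · refine (tsum_of_norm_bounded (hsum.mul_left (2 * r)) hbound).trans (le_of_eq (by ring))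
  have hanti : Antitone fun n => f (z n) + ∑ k ∈ Finset.range n, κ' k * ‖z n - z k‖ ^ 2 :=
    antitone_nat_of_succ_le hdec
  have hle : ∀ n, f y + ∑ k ∈ Finset.range n, κ' k * ‖y - z k‖ ^ 2 ≤
      f w + ∑ k ∈ Finset.range n, κ' k * ‖w - z k‖ ^ 2 + ε n := by
    intro n
    have ht : Tendsto (fun j => f (z j) + ∑ k ∈ Finset.range n, κ' k * ‖z j - z k‖ ^ 2) atTop
        (𝓝 (f y + ∑ k ∈ Finset.range n, κ' k * ‖y - z k‖ ^ 2)) :=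
      ((hcont.tendsto y).comp hy).add
        (tendsto_finsetSum _ fun k _ => ((hy.sub_const (z k)).norm.pow 2).const_mul _)
    refine le_of_tendsto ht (eventually_atTop.2 ⟨n, fun j hj => ?_⟩)
    refine le_trans ?_ ((hanti hj).trans (hmin n w hw))
    exact add_le_add le_rfl (Finset.sum_le_sum_of_subset_of_nonneg (Finset.range_mono hj)
      fun k _ _ => mul_nonneg (hκ' k).le (sq_nonneg _))
  have hle' : ∀ n, f y ≤ f w + ⟪∑ k ∈ Finset.range n, (2 * κ' k) • (y - z k), w - y⟫ +
      (∑ k ∈ Finset.range n, κ' k) * ‖w - y‖ ^ 2 + ε n := by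
    intro n
    have h1 : ∑ k ∈ Finset.range n, κ' k * ‖w - z k‖ ^ 2 -
        ∑ k ∈ Finset.range n, κ' k * ‖y - z k‖ ^ 2 =
        ⟪∑ k ∈ Finset.range n, (2 * κ' k) • (y - z k), w - y⟫ +
          (∑ k ∈ Finset.range n, κ' k) * ‖w - y‖ ^ 2 := by
      rw [sum_inner, Finset.sum_mul, ← Finset.sum_sub_distrib, ← Finset.sum_add_distrib]
      refine Finset.sum_congr rfl fun k _ => ?_
      rw [← mul_sub, norm_sub_sq_sub_norm_sub_sq, real_inner_smul_left]
      ring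
    linarith [hle n]
  have hε0 : Tendsto ε atTop (𝓝 0) := by
    have h : Tendsto (fun n : ℕ => r / 2 / 2 ^ n) atTop (𝓝 0) :=
      (hasSum_geometric_two' r).summable.tendsto_atTop_zero
    simpa using hsum.summable.tendsto_atTop_zero.mul (h.pow 2)
  have ht := ((hsummable.hasSum.tendsto_sum_nat.inner (tendsto_const_nhds (x := w - y))).const_add
    (f w)).add (hsum.tendsto_sum_nat.mul_const (‖w - y‖ ^ 2)) |>.add hε0
  simpa using ge_of_tendsto' ht hle'

end Hilbert

/-! ### Primal and dual regularity of a set along a subspace. -/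

section Hilbert

variable {H : Type*} [NormedAddCommGroup H] [InnerProductSpace ℝ H]

/-- AM-GM: s ≤ (‖p‖² + s²) / (2‖p‖) with s = ‖p + h‖. The quadratic remainder is what makes the
normal below proximal. -/
theorem norm_add_le_norm_add_inner_div (p h : H) (hp : p ≠ 0) :
    ‖p + h‖ ≤ ‖p‖ + ⟪p, h⟫ / ‖p‖ + ‖h‖ ^ 2 / (2 * ‖p‖) := by
  have hp' : 0 < ‖p‖ := norm_pos_iff.2 hp
  have h1 : ‖p‖ + ⟪p, h⟫ / ‖p‖ + ‖h‖ ^ 2 / (2 * ‖p‖) = (‖p‖ ^ 2 + ‖p + h‖ ^ 2) / (2 * ‖p‖) := by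
    rw [norm_add_sq_real]
    field_simp
    ring
  rw [h1, le_div_iff₀ (by positivity)]
  nlinarith [sq_nonneg (‖p‖ - ‖p + h‖)]

variable [CompleteSpace H]

/-- A proximal normal is a Fréchet normal. -/
theorem toDual_mem_frechetNormalCone_of_proximal {C : Set H} {y v : H} {σ : ℝ}
    (h : ∀ z ∈ C, ⟪v, z - y⟫ ≤ σ * ‖z - y‖ ^ 2) :
    InnerProductSpace.toDual ℝ H v ∈ frechetNormalCone C y := by
  intro ε hε
  have h1 : ∀ᶠ z in 𝓝[C] y, σ * ‖z - y‖ < ε := by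
    have : Tendsto (fun z => σ * ‖z - y‖) (𝓝 y) (𝓝 0) := by
      have : Continuous fun z => σ * ‖z - y‖ := by fun_prop
      simpa using this.tendsto y
    exact (this.mono_left nhdsWithin_le_nhds).eventually_lt_const hε
  filter_upwards [h1, self_mem_nhdsWithin] with z hz hzC
  rw [InnerProductSpace.toDual_apply_apply]
  nlinarith [h z hzC, norm_nonneg (z - y)]

variable (C : Set H) (L : Submodule ℝ H) [L.HasOrthogonalProjection] (x : H)

/-- The primal regularity of a set relative to a subspace: translates of `C` by small vectors still
meet `L` near the origin, with a linear rate. -/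
def RegularAlong : Prop :=
  ∃ δ > (0 : ℝ), ∃ α > (0 : ℝ), ∀ ρ ∈ Set.Ioc (0 : ℝ) δ, ∀ ω ∈ C ∩ Metric.closedBall x δ,
    ∀ a : H, ‖a‖ ≤ α * ρ → ∃ l ∈ L, ‖l‖ ≤ ρ ∧ l + ω + a ∈ C

/-- The dual regularity of a set relative to a subspace: the normals to `C` near `x` stay away from
the orthogonal complement of `L`. -/
def DuallyRegularAlong : Prop :=
  ∃ δ > (0 : ℝ), ∃ c > (0 : ℝ), ∀ v : H,
    InnerProductSpace.toDual ℝ H v ∈ strictNormalCone C x δ → c * ‖v‖ ≤ ‖L.starProjection v‖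

variable {C L x}

theorem RegularAlong.duallyRegularAlong (h : RegularAlong C L x) : DuallyRegularAlong C L x := by
  obtain ⟨δ, hδ, α, hα, H1⟩ := h
  refine ⟨δ, hδ, α, hα, fun v hv => ?_⟩
  simp only [strictNormalCone, Set.mem_iUnion, exists_prop] at hv
  obtain ⟨z, hz, hv⟩ := hv
  rcases eq_or_ne v 0 with rfl | hv0
  · simp
  have hv' : 0 < ‖v‖ := norm_pos_iff.2 hv0
  refine le_of_forall_pos_le_add fun ε hε => ?_
  obtain ⟨r, hr, hball⟩ := Metric.mem_nhdsWithin_iff.1 (hv (ε / (1 + α)) (by positivity))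
  -- Since ‖l + a‖ ≤ (1 + α)ρ, the displaced point stays where the Fréchet inequality is known.
  set ρ := min δ (r / (2 * (1 + α))) with hρ
  have hρ0 : 0 < ρ := lt_min hδ (by positivity)
  have hρr : (1 + α) * ρ < r := by
    have : ρ ≤ r / (2 * (1 + α)) := min_le_right _ _
    rw [le_div_iff₀ (by positivity)] at this
    nlinarith
  set a := (α * ρ / ‖v‖) • v with ha
  have hanorm : ‖a‖ = α * ρ := by
    rw [ha, norm_smul, Real.norm_of_nonneg (by positivity)]
    field_simp
  obtain ⟨l, hlL, hl, hlC⟩ := H1 ρ ⟨hρ0, min_le_left _ _⟩ z hz a hanorm.le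
  have hsub : l + z + a - z = l + a := by abel
  have hla : ‖l + a‖ ≤ (1 + α) * ρ := (norm_add_le _ _).trans (by rw [hanorm]; linarith)
  have hmem : l + z + a ∈ Metric.ball z r ∩ C :=
    ⟨by rw [Metric.mem_ball, dist_eq_norm, hsub]; exact hla.trans_lt hρr, hlC⟩
  have h2 := hball hmem
  simp only [Set.mem_ofPred_eq, hsub, InnerProductSpace.toDual_apply_apply] at h2
  have h3 : ε / (1 + α) * ‖l + a‖ ≤ ε * ρ := by
    calc ε / (1 + α) * ‖l + a‖ ≤ ε / (1 + α) * ((1 + α) * ρ) := by gcongr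
      _ = ε * ρ := by field_simp
  have h4 : ⟪v, a⟫ = α * ρ * ‖v‖ := by
    rw [ha, real_inner_smul_right, real_inner_self_eq_norm_sq]
    field_simp
  have h5 : ⟪v, l⟫ = ⟪L.starProjection v, l⟫ := by
    rw [Submodule.inner_starProjection_left_eq_right, Submodule.starProjection_eq_self_iff.2 hlL]
  have h6 : -(‖L.starProjection v‖ * ρ) ≤ ⟪v, l⟫ := by
    rw [h5]
    have := neg_le_of_abs_le (abs_real_inner_le_norm (L.starProjection v) l)
    have h7 : ‖L.starProjection v‖ * ‖l‖ ≤ ‖L.starProjection v‖ * ρ := by gcongr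
    linarith
  rw [inner_add_right] at h2
  nlinarith

theorem DuallyRegularAlong.regularAlong (hC : IsClosed C) (h : DuallyRegularAlong C L x) :
    RegularAlong C L x := by
  obtain ⟨δ, hδ, c, hc, H1⟩ := h
  -- With penalty weight 32α/ρ and radius ρ/2, the principle accepts the starting value αρ and gives
  -- ‖q‖ ≤ 32α. The angle condition would then yield c(1 - 32α) ≤ 32α, whereas 32α(1 + c) = c/2.
  set α := c / (64 * (1 + c)) with hαdef
  have hα : 0 < α := by positivity
  have hα1 : 64 * (α * (1 + c)) = c := by rw [hαdef]; field_simp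
  have hα2 : α ≤ 1 / 2 := by nlinarith
  refine ⟨δ / 2, half_pos hδ, α, hα, fun ρ hρ ω hω a ha => ?_⟩
  obtain ⟨hρ0, hρδ⟩ := hρ
  have hf0 : ‖Lᗮ.starProjection (ω - (ω + a))‖ ≤ 32 * α / ρ * (ρ / 2) ^ 2 / 8 := by
    refine (Submodule.norm_starProjection_apply_le _ _).trans ?_
    rw [sub_add_cancel_left, norm_neg]
    refine ha.trans (le_of_eq ?_)
    field_simp
    norm_num
  obtain ⟨y, hyC, q, hyω, hq, hmin⟩ := smooth_variational_principle hC
    (f := fun z => ‖Lᗮ.starProjection (z - (ω + a))‖) (by fun_prop) (fun _ _ => norm_nonneg _)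
    (by positivity : (0 : ℝ) < 32 * α / ρ) (half_pos hρ0) hω.1 hf0
  have hq' : ‖q‖ ≤ 32 * α := hq.trans (le_of_eq (by field_simp))
  -- At value zero, y - (ω + a) is the required element of L. Otherwise the objective is smooth at y
  -- with gradient u ∈ Lᗮ, so -(u + q) is normal to C.
  rcases eq_or_ne (Lᗮ.starProjection (y - (ω + a))) 0 with h0 | h0
  · refine ⟨y - (ω + a), ?_, ?_, ?_⟩
    · rwa [Submodule.starProjection_apply_eq_zero_iff, Submodule.orthogonal_orthogonal] at h0
    · rw [← sub_sub]
      refine (norm_sub_le _ _).trans ?_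
      nlinarith
    · rwa [add_assoc, sub_add_cancel]
  exfalso
  set p := Lᗮ.starProjection (y - (ω + a)) with hp
  have hp0 : 0 < ‖p‖ := norm_pos_iff.2 h0
  have hpL : p ∈ Lᗮ := Submodule.starProjection_apply_mem _ _
  set u := ‖p‖⁻¹ • p with hu
  have hunorm : ‖u‖ = 1 := norm_smul_inv_norm h0
  have huL : L.starProjection u = 0 :=
    (Submodule.starProjection_apply_eq_zero_iff _).2 (Submodule.smul_mem _ _ hpL)
  have hv : InnerProductSpace.toDual ℝ H (-(u + q)) ∈ strictNormalCone C x δ := by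
    refine Set.mem_biUnion (x := y) ⟨hyC, ?_⟩ ?_
    · rw [Metric.mem_closedBall]
      have h1 : dist y ω ≤ ρ / 2 := by rwa [dist_eq_norm]
      have h2 : dist ω x ≤ δ / 2 := hω.2
      linarith [dist_triangle y ω x]
    · refine toDual_mem_frechetNormalCone_of_proximal
        (σ := 32 * α / ρ + 1 / (2 * ‖p‖)) fun z hz => ?_
      have h1 := hmin z hz
      have h2 : Lᗮ.starProjection (z - (ω + a)) = p + Lᗮ.starProjection (z - y) := by
        rw [hp, ← map_add]
        congr 1
        abel
      have h3 := norm_add_le_norm_add_inner_div p (Lᗮ.starProjection (z - y)) h0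
      have h4 : ⟪p, Lᗮ.starProjection (z - y)⟫ = ⟪p, z - y⟫ := by
        rw [← Submodule.inner_starProjection_left_eq_right,
          Submodule.starProjection_eq_self_iff.2 hpL]
      have h5 : ‖Lᗮ.starProjection (z - y)‖ ^ 2 / (2 * ‖p‖) ≤ 1 / (2 * ‖p‖) * ‖z - y‖ ^ 2 := by
        rw [one_div_mul_eq_div]
        gcongr
        exact Submodule.norm_starProjection_apply_le _ _
      have h6 : ⟪u, z - y⟫ = ⟪p, z - y⟫ / ‖p‖ := by
        rw [hu, real_inner_smul_left, inv_mul_eq_div]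
      simp only [h2] at h1
      rw [inner_neg_left, inner_add_left, h6]
      rw [h4] at h3
      linarith
  have h1 := H1 _ hv
  rw [norm_neg, map_neg, norm_neg, map_add, huL, zero_add] at h1
  have h2 : ‖L.starProjection q‖ ≤ 32 * α :=
    (Submodule.norm_starProjection_apply_le _ _).trans hq'
  have h3 : 1 - 32 * α ≤ ‖u + q‖ := by
    have := norm_sub_le (u + q) q
    rw [add_sub_cancel_right, hunorm] at this
    linarith
  nlinarith

theorem regularAlong_iff_duallyRegularAlong (hC : IsClosed C) :
    RegularAlong C L x ↔ DuallyRegularAlong C L x :=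
  ⟨RegularAlong.duallyRegularAlong, DuallyRegularAlong.regularAlong hC⟩

end Hilbert

/-! ### The limiting constants as uniform estimates. -/

section Constants

variable {X : Type*} [NormedAddCommGroup X] [NormedSpace ℝ X]

theorem etaHat_pos_iff {ι : Type*} [Fintype ι] (Ω : ι → Set X) (x : X) :
    0 < etaHat Ω x ↔ ∃ δ > (0 : ℝ), ∃ c > (0 : ℝ), ∀ f : ι → StrongDual ℝ X,
      (∀ i, f i ∈ strictNormalCone (Ω i) x δ) → ∑ i, ‖f i‖ = 1 → c ≤ ‖∑ i, f i‖ := by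
  constructor
  · intro h
    obtain ⟨δ, hc, hδ⟩ := (((tendsto_etaInf Ω x).eventually_const_lt h).and
      self_mem_nhdsWithin).exists
    refine ⟨δ, hδ, etaInf Ω x δ, hc, fun f hf h1 => ?_⟩
    have hmem : ‖∑ i, f i‖ ∈ etaSet Ω x δ := ⟨f, hf, h1, rfl⟩
    rw [etaInf, if_pos ⟨_, hmem⟩]
    exact csInf_le ⟨0, fun r hr => (etaSet_subset Ω x δ hr).1⟩ hmem
  · rintro ⟨δ, hδ, c, hc, h⟩
    -- The 1 covers the empty set, where the infimum is 1 by convention.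
    have hle : min c 1 ≤ etaInf Ω x δ := by
      unfold etaInf
      split_ifs with hne
      · refine le_csInf hne ?_
        rintro _ ⟨f, hf, h1, rfl⟩
        exact (min_le_left _ _).trans (h f hf h1)
      · exact min_le_right _ _
    refine (lt_min hc one_pos).trans_le (ge_of_tendsto (tendsto_etaInf Ω x) ?_)
    filter_upwards [Ioc_mem_nhdsGT hδ] with t ht
    exact hle.trans (etaInf_antitone Ω x ht.2)

theorem etaHat_nonneg {ι : Type*} [Fintype ι] (Ω : ι → Set X) (x : X) : 0 ≤ etaHat Ω x := by
  refine ge_of_tendsto' (tendsto_etaInf Ω x) fun δ => ?_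
  unfold etaInf
  split_ifs
  · exact Real.sInf_nonneg fun r hr => (etaSet_subset Ω x δ hr).1
  · exact zero_le_one

theorem cHat_lt_one_iff {ι : Type*} [Fintype ι] (Ω : ι → Set X) (x : X) :
    cHat Ω x < 1 ↔ 0 < etaHat Ω x := by
  unfold cHat
  constructor
  · intro h
    refine lt_of_le_of_ne (etaHat_nonneg Ω x) fun h0 => ?_
    rw [← h0] at h
    norm_num at h
  · intro h
    have := pow_pos h 2
    linarith

theorem nuHat_lt_one_iff (Ω : Fin 2 → Set X) (x : X) :
    nuHat Ω x < 1 ↔ ∃ δ > (0 : ℝ), ∃ c : ℝ, 0 ≤ c ∧ c < 1 ∧ ∀ f : Fin 2 → StrongDual ℝ X,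
      (∀ i, f i ∈ strictNormalCone (Ω i) x δ) → (∀ i, ‖f i‖ = 1 / 2) → ‖f 0 - f 1‖ ≤ c := by
  constructor
  · intro h
    obtain ⟨δ, hc, hδ⟩ := (((tendsto_nuSup Ω x).eventually_lt_const h).and
      self_mem_nhdsWithin).exists
    refine ⟨δ, hδ, max 0 (nuSup Ω x δ), le_max_left _ _, max_lt one_pos hc, fun f hf h1 => ?_⟩
    have hmem : ‖f 0 - f 1‖ ∈ nuSet Ω x δ := ⟨f, hf, h1, rfl⟩
    refine le_trans ?_ (le_max_right _ _)
    rw [nuSup, if_pos ⟨_, hmem⟩]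
    exact le_csSup ⟨1, fun r hr => (nuSet_subset Ω x δ hr).2⟩ hmem
  · rintro ⟨δ, hδ, c, hc0, hc, h⟩
    have hle : nuSup Ω x δ ≤ c := by
      unfold nuSup
      split_ifs with hne
      · refine csSup_le hne ?_
        rintro _ ⟨f, hf, h1, rfl⟩
        exact h f hf h1
      · exact hc0
    refine lt_of_le_of_lt (le_of_tendsto (tendsto_nuSup Ω x) ?_) hc
    filter_upwards [Ioc_mem_nhdsGT hδ] with t ht
    exact (nuSup_monotone Ω x ht.2).trans hle

theorem smul_mem_strictNormalCone {Ω : Set X} {x : X} {δ : ℝ} {f : StrongDual ℝ X}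
    (hf : f ∈ strictNormalCone Ω x δ) {t : ℝ} (ht : 0 < t) :
    t • f ∈ strictNormalCone Ω x δ := by
  simp only [strictNormalCone, Set.mem_iUnion, exists_prop] at hf ⊢
  obtain ⟨y, hy, hf⟩ := hf
  refine ⟨y, hy, fun ε hε => ?_⟩
  filter_upwards [hf (ε / t) (div_pos hε ht)] with u hu
  calc (t • f) (u - y) = t * f (u - y) := rfl
    _ ≤ t * (ε / t * ‖u - y‖) := by gcongr
    _ = ε * ‖u - y‖ := by field_simp

end Constants

/-! ### Comparison of the constants in a Hilbert space. -/

section Hilbert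

variable {H : Type*} [NormedAddCommGroup H] [InnerProductSpace ℝ H]

/-- If the normalizations of `v` and `w` to norm `1 / 2` are at distance at most `c`, then
`v + w` is bounded below in terms of `‖v‖ + ‖w‖`. -/
theorem mul_sq_le_norm_add_sq {v w : H} (hv : v ≠ 0) (hw : w ≠ 0) {c : ℝ}
    (h : ‖(1 / (2 * ‖v‖)) • v - (1 / (2 * ‖w‖)) • w‖ ≤ c) :
    (1 - c ^ 2) * (‖v‖ + ‖w‖) ^ 2 ≤ ‖v + w‖ ^ 2 := by
  have hv' : 0 < ‖v‖ := norm_pos_iff.2 hv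
  have hw' : 0 < ‖w‖ := norm_pos_iff.2 hw
  have h1 := pow_le_pow_left₀ (norm_nonneg _) h 2
  rw [norm_sub_sq_real, real_inner_smul_left, real_inner_smul_right, norm_smul, norm_smul,
    Real.norm_of_nonneg (by positivity), Real.norm_of_nonneg (by positivity)] at h1
  have h2 : (1 / (2 * ‖v‖) * ‖v‖) ^ 2 - 2 * (1 / (2 * ‖v‖) * (1 / (2 * ‖w‖) * ⟪v, w⟫)) +
      (1 / (2 * ‖w‖) * ‖w‖) ^ 2 = (‖v‖ * ‖w‖ - ⟪v, w⟫) / (2 * (‖v‖ * ‖w‖)) := by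
    field_simp
    ring
  rw [h2, div_le_iff₀ (by positivity)] at h1
  rw [norm_add_sq_real]
  -- `h1` gives ‖v + w‖² ≥ (‖v‖ + ‖w‖)² - 4c²‖v‖‖w‖, and 4‖v‖‖w‖ ≤ (‖v‖ + ‖w‖)².
  nlinarith [mul_nonneg (sq_nonneg c) (sq_nonneg (‖v‖ - ‖w‖))]

variable [CompleteSpace H]

theorem dual_parallelogram (f g : StrongDual ℝ H) :
    ‖f + g‖ ^ 2 + ‖f - g‖ ^ 2 = 2 * (‖f‖ ^ 2 + ‖g‖ ^ 2) := by
  obtain ⟨v, rfl⟩ := (InnerProductSpace.toDual ℝ H).surjective f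
  obtain ⟨w, rfl⟩ := (InnerProductSpace.toDual ℝ H).surjective g
  rw [← map_add, ← map_sub]
  simp only [LinearIsometryEquiv.norm_map]
  linarith [parallelogram_law_with_norm ℝ v w]

theorem etaHat_pos_iff_nuHat_lt_one (S : Fin 2 → Set H) (x : H) :
    0 < etaHat S x ↔ nuHat S x < 1 := by
  rw [etaHat_pos_iff, nuHat_lt_one_iff]
  simp only [Fin.sum_univ_two]
  constructor
  · rintro ⟨δ, hδ, c, hc, h⟩
    refine ⟨δ, hδ, √(1 - c ^ 2), Real.sqrt_nonneg _, ?_, fun f hf h1 => ?_⟩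
    · rw [Real.sqrt_lt' one_pos]
      nlinarith
    · have h2 := h f hf (by rw [h1, h1]; norm_num)
      have h3 := dual_parallelogram (f 0) (f 1)
      rw [h1, h1] at h3
      refine Real.le_sqrt_of_sq_le ?_
      nlinarith
  · rintro ⟨δ, hδ, c, hc0, hc, h⟩
    have hc2 : 0 < 1 - c ^ 2 := by nlinarith
    refine ⟨δ, hδ, √(1 - c ^ 2), Real.sqrt_pos.2 hc2, fun f hf h1 => ?_⟩
    refine Real.sqrt_le_iff.2 ⟨norm_nonneg _, ?_⟩
    -- A zero functional cannot be normalized to norm 1/2, but then the sum has norm 1.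
    by_cases h0 : f 0 = 0
    · rw [h0, norm_zero, zero_add] at h1
      rw [h0, zero_add, h1]
      nlinarith
    by_cases h0' : f 1 = 0
    · rw [h0', norm_zero, add_zero] at h1
      rw [h0', add_zero, h1]
      nlinarith
    have hf0 : 0 < ‖f 0‖ := norm_pos_iff.2 h0
    have hf1 : 0 < ‖f 1‖ := norm_pos_iff.2 h0'
    have h2 := h (fun i => (1 / (2 * ‖f i‖)) • f i)
      (Fin.forall_fin_two.2 ⟨smul_mem_strictNormalCone (hf 0) (by positivity),
        smul_mem_strictNormalCone (hf 1) (by positivity)⟩)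
      (Fin.forall_fin_two.2 ⟨by
        rw [norm_smul, Real.norm_of_nonneg (by positivity)]; field_simp, by
        rw [norm_smul, Real.norm_of_nonneg (by positivity)]; field_simp⟩)
    obtain ⟨v, hv⟩ := (InnerProductSpace.toDual ℝ H).surjective (f 0)
    obtain ⟨w, hw⟩ := (InnerProductSpace.toDual ℝ H).surjective (f 1)
    rw [← hv, ← hw] at h2 h1 ⊢
    rw [← hv] at h0
    rw [← hw] at h0'
    rw [← map_add]
    simp only [LinearIsometryEquiv.norm_map] at h1 h2 ⊢
    have h3 : (1 / (2 * ‖v‖)) • InnerProductSpace.toDual ℝ H v -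
        (1 / (2 * ‖w‖)) • InnerProductSpace.toDual ℝ H w =
        InnerProductSpace.toDual ℝ H ((1 / (2 * ‖v‖)) • v - (1 / (2 * ‖w‖)) • w) := by
      simp [map_sub]
    rw [h3, LinearIsometryEquiv.norm_map] at h2
    have h4 := mul_sq_le_norm_add_sq (fun hv0 => h0 (by rw [hv0, map_zero]))
      (fun hw0 => h0' (by rw [hw0, map_zero])) h2
    rwa [h1, one_pow, mul_one] at h4

/-- The normals to a subspace at its points are the vectors orthogonal to it. -/
theorem toDual_mem_strictNormalCone_submodule_iff {L : Submodule ℝ H} {x : H} (hx : x ∈ L)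
    {δ : ℝ} (hδ : 0 ≤ δ) {v : H} :
    InnerProductSpace.toDual ℝ H v ∈ strictNormalCone (L : Set H) x δ ↔ v ∈ Lᗮ := by
  constructor
  · intro h
    simp only [strictNormalCone, Set.mem_iUnion, exists_prop] at h
    obtain ⟨y, ⟨hyL, -⟩, hv⟩ := h
    -- Test the normal inequality along y + t l as t ↓ 0; the factor t cancels.
    have hle : ∀ l ∈ L, ⟪v, l⟫ ≤ 0 := by
      intro l hl
      refine le_of_forall_pos_le_add fun ε hε => ?_
      have hev := hv (ε / (‖l‖ + 1)) (by positivity)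
      have ht : Tendsto (fun t : ℝ => y + t • l) (𝓝[>] 0) (𝓝[(L : Set H)] y) := by
        refine tendsto_nhdsWithin_iff.2 ⟨?_, Eventually.of_forall fun t =>
          L.add_mem hyL (L.smul_mem t hl)⟩
        have : Continuous fun t : ℝ => y + t • l := by fun_prop
        simpa using (this.tendsto 0).mono_left nhdsWithin_le_nhds
      obtain ⟨t, h1, ht0⟩ := ((ht.eventually hev).and self_mem_nhdsWithin).exists
      have ht0 : 0 < t := ht0
      rw [add_sub_cancel_left, InnerProductSpace.toDual_apply_apply, real_inner_smul_right,
        norm_smul, Real.norm_of_nonneg ht0.le, mul_left_comm] at h1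
      have h2 := le_of_mul_le_mul_left h1 ht0
      have h3 : ε / (‖l‖ + 1) * ‖l‖ ≤ ε := by
        rw [div_mul_eq_mul_div, div_le_iff₀ (by positivity)]
        nlinarith [norm_nonneg l]
      linarith
    rw [Submodule.mem_orthogonal']
    intro l hl
    refine le_antisymm (hle l hl) ?_
    have := hle (-l) (L.neg_mem hl)
    rw [inner_neg_right] at this
    linarith
  · intro hv
    refine Set.mem_biUnion (x := x) ⟨hx, Metric.mem_closedBall_self hδ⟩ ?_
    refine toDual_mem_frechetNormalCone_of_proximal (σ := 0) fun z hz => ?_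
    rw [zero_mul]
    exact ((Submodule.mem_orthogonal' L v).1 hv _ (L.sub_mem hz hx)).le

theorem etaHat_pos_iff_duallyRegularAlong {C : Set H} {L : Submodule ℝ H}
    [L.HasOrthogonalProjection] {x : H} (hx : x ∈ L) :
    0 < etaHat ![C, (L : Set H)] x ↔ DuallyRegularAlong C L x := by
  rw [etaHat_pos_iff]
  simp only [Fin.sum_univ_two, Fin.forall_fin_two, Matrix.cons_val_zero, Matrix.cons_val_one]
  constructor
  · rintro ⟨δ, hδ, c, hc, h⟩
    refine ⟨δ, hδ, c, hc, fun v hv => ?_⟩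
    rcases eq_or_ne v 0 with rfl | hv0
    · simp
    -- The element of Lᗮ minimizing ‖v + g‖.
    set g := -(Lᗮ.starProjection v) with hg
    have hgL : g ∈ Lᗮ := Submodule.neg_mem _ (Submodule.starProjection_apply_mem _ _)
    have hs : 0 < ‖v‖ + ‖g‖ := add_pos_of_pos_of_nonneg (norm_pos_iff.2 hv0) (norm_nonneg _)
    have hvg : v + g = L.starProjection v := by
      nth_rw 1 [← Submodule.starProjection_add_starProjection_orthogonal (K := L) v]
      rw [hg, add_neg_cancel_right]
    set t := (‖v‖ + ‖g‖)⁻¹ with ht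
    have ht0 : 0 < t := inv_pos.2 hs
    have h1 := h ![t • InnerProductSpace.toDual ℝ H v, t • InnerProductSpace.toDual ℝ H g]
      ⟨smul_mem_strictNormalCone hv ht0, smul_mem_strictNormalCone
        ((toDual_mem_strictNormalCone_submodule_iff hx hδ.le).2 hgL) ht0⟩ (by
        simp only [Matrix.cons_val_zero, Matrix.cons_val_one]
        rw [norm_smul, norm_smul, LinearIsometryEquiv.norm_map, LinearIsometryEquiv.norm_map,
          Real.norm_of_nonneg ht0.le, ← mul_add]
        exact inv_mul_cancel₀ hs.ne')
    simp only [Matrix.cons_val_zero, Matrix.cons_val_one] at h1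
    rw [← smul_add, ← map_add, norm_smul, LinearIsometryEquiv.norm_map,
      Real.norm_of_nonneg ht0.le, hvg, ht, inv_mul_eq_div, le_div_iff₀ hs] at h1
    nlinarith [norm_nonneg g]
  · rintro ⟨δ, hδ, c, hc, h⟩
    -- With s = ‖v + g‖: c‖v‖ ≤ s and 1 = ‖v‖ + ‖g‖ ≤ s + 2‖v‖, so c ≤ (c + 2)s.
    refine ⟨δ, hδ, c / (c + 2), by positivity, fun f hf h1 => ?_⟩
    obtain ⟨v, hv⟩ := (InnerProductSpace.toDual ℝ H).surjective (f 0)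
    obtain ⟨g, hg⟩ := (InnerProductSpace.toDual ℝ H).surjective (f 1)
    rw [← hv, ← hg] at hf h1 ⊢
    rw [← map_add]
    simp only [LinearIsometryEquiv.norm_map] at h1 ⊢
    have hgL := (toDual_mem_strictNormalCone_submodule_iff hx hδ.le).1 hf.2
    have h2 : c * ‖v‖ ≤ ‖v + g‖ := by
      have h3 := Submodule.norm_starProjection_apply_le L (v + g)
      rw [map_add, (Submodule.starProjection_apply_eq_zero_iff _).2 hgL, add_zero] at h3
      exact (h v hf.1).trans h3
    have h4 : ‖g‖ ≤ ‖v + g‖ + ‖v‖ := by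
      have := norm_sub_le (v + g) v
      rwa [add_sub_cancel_left] at this
    rw [div_le_iff₀ (by positivity)]
    nlinarith

end Hilbert

/-! ### Passage to the product space. -/

section Product

variable {X : Type*} [NormedAddCommGroup X] {m : ℕ}

theorem norm_le_sqrt_mul_of_forall_le {z : PiLp 2 (fun _ : Fin m => X)} {r : ℝ} (hr : 0 ≤ r)
    (h : ∀ i, ‖z i‖ ≤ r) : ‖z‖ ≤ √m * r := by
  rw [PiLp.norm_eq_of_L2, Real.sqrt_le_left (by positivity), mul_pow,
    Real.sq_sqrt (Nat.cast_nonneg m)]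
  calc ∑ i, ‖z i‖ ^ 2 ≤ ∑ _i : Fin m, r ^ 2 :=
        Finset.sum_le_sum fun i _ => pow_le_pow_left₀ (norm_nonneg _) (h i) 2
    _ = m * r ^ 2 := by simp

variable [InnerProductSpace ℝ X]

/-- The diagonal of `X ^ m` as a subspace. -/
def diagonalSubmodule (m : ℕ) (X : Type*) [NormedAddCommGroup X] [InnerProductSpace ℝ X] :
    Submodule ℝ (PiLp 2 (fun _ : Fin m => X)) where
  carrier := Set.range (diagPoint m)
  add_mem' := by
    rintro _ _ ⟨x, rfl⟩ ⟨y, rfl⟩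
    exact ⟨x + y, rfl⟩
  zero_mem' := ⟨0, rfl⟩
  smul_mem' := by
    rintro c _ ⟨x, rfl⟩
    exact ⟨c • x, rfl⟩

theorem isClosed_diagonalSubmodule (hm : 0 < m) :
    IsClosed (diagonalSubmodule m X : Set (PiLp 2 (fun _ : Fin m => X))) := by
  have h : (diagonalSubmodule m X : Set (PiLp 2 (fun _ : Fin m => X))) =
      ⋂ i, {z | z i = z ⟨0, hm⟩} := by
    ext z
    simp only [Set.mem_iInter, Set.mem_ofPred_eq]
    constructor
    · rintro ⟨x, rfl⟩ i
      rfl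
    · intro h
      exact ⟨z ⟨0, hm⟩, by ext i; exact (h i).symm⟩
  rw [h]
  exact isClosed_iInter fun i => isClosed_eq (by fun_prop) (by fun_prop)

/-- Uniform regularity bounds coordinates separately, `RegularAlong` the Euclidean norm; max ‖z i‖ ≤
‖z‖ ≤ √m max ‖z i‖ accounts for every `√m`. -/
theorem uniformlyRegular_iff_regularAlong (hm : 0 < m) (Ω : Fin m → Set X) (x : X) :
    UniformlyRegular Ω x ↔
      RegularAlong {z : PiLp 2 (fun _ : Fin m => X) | ∀ i, z i ∈ Ω i} (diagonalSubmodule m X)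
        (diagPoint m x) := by
  have hm1 : 1 ≤ √(m : ℝ) := Real.one_le_sqrt.2 (by exact_mod_cast hm)
  have hm0 : 0 < √(m : ℝ) := one_pos.trans_le hm1
  constructor
  · rintro ⟨δ, hδ, α, hα, h⟩
    refine ⟨δ, hδ, α / √m, by positivity, fun ρ hρ ω hω a ha => ?_⟩
    have hρ0 := hρ.1
    obtain ⟨w, hw, hwρ⟩ := h (ρ / √m)
      ⟨by positivity, (div_le_self hρ0.le hm1).trans hρ.2⟩ (fun i => ω i) (fun i => a i)
      (fun i => ⟨hω.1 i, by
        have h1 : dist ω (diagPoint m x) ≤ δ := hω.2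
        rw [Metric.mem_closedBall, dist_eq_norm]
        rw [dist_eq_norm] at h1
        exact (PiLp.norm_apply_le (ω - diagPoint m x) i).trans h1⟩)
      (fun i => by
        rw [mem_closedBall_zero_iff]
        exact (PiLp.norm_apply_le a i).trans (ha.trans (le_of_eq (by ring))))
    rw [mem_closedBall_zero_iff] at hwρ
    refine ⟨diagPoint m w, ⟨w, rfl⟩, ?_, fun i => ?_⟩
    · refine (norm_le_sqrt_mul_of_forall_le (by positivity) fun _ => hwρ).trans (le_of_eq ?_)
      field_simp
    · obtain ⟨y, hy, hyw⟩ := Set.mem_iInter.1 hw i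
      have : (diagPoint m w + ω + a) i = y := by
        change w + ω i + a i = y
        simp only [← hyw]
        rw [sub_right_comm, sub_add_cancel, sub_add_cancel]
      rwa [this]
  · rintro ⟨δ, hδ, α, hα, h⟩
    refine ⟨δ / √m, by positivity, α / √m, by positivity, fun ρ hρ ω a hω ha => ?_⟩
    have hρ0 := hρ.1
    obtain ⟨_, ⟨w, rfl⟩, hwρ, hw⟩ := h ρ ⟨hρ0, hρ.2.trans (div_le_self hδ.le hm1)⟩
      (WithLp.toLp 2 ω) ⟨fun i => (hω i).1, by
        rw [Metric.mem_closedBall, dist_eq_norm]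
        refine (norm_le_sqrt_mul_of_forall_le (r := δ / √m) (by positivity) fun i => ?_).trans
          (le_of_eq (by field_simp))
        have h1 := (hω i).2
        rwa [Metric.mem_closedBall, dist_eq_norm] at h1⟩
      (WithLp.toLp 2 a) ((norm_le_sqrt_mul_of_forall_le (r := α / √m * ρ) (by positivity)
        fun i => mem_closedBall_zero_iff.1 (ha i)).trans (le_of_eq (by field_simp)))
    refine ⟨w, Set.mem_iInter.2 fun i => ⟨w + ω i + a i, hw i, by simp only; abel⟩, ?_⟩
    rw [mem_closedBall_zero_iff]
    exact (PiLp.norm_apply_le (diagPoint m w) ⟨0, hm⟩).trans hwρ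

theorem uniformlyRegular_iff_etaHat_pos [CompleteSpace X] (hm : 0 < m) (Ω : Fin m → Set X)
    (hΩ : ∀ i, IsClosed (Ω i)) (x : X) :
    UniformlyRegular Ω x ↔ 0 < etaHat (productPair Ω) (diagPoint m x) := by
  have : CompleteSpace (diagonalSubmodule m X) :=
    (isClosed_diagonalSubmodule hm).completeSpace_coe
  have hC : IsClosed {z : PiLp 2 (fun _ : Fin m => X) | ∀ i, z i ∈ Ω i} := by
    rw [Set.ofPred_forall]
    exact isClosed_iInter fun i => (hΩ i).preimage (by fun_prop)
  rw [uniformlyRegular_iff_regularAlong hm, regularAlong_iff_duallyRegularAlong hC,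
    ← etaHat_pos_iff_duallyRegularAlong (L := diagonalSubmodule m X) ⟨x, rfl⟩]
  rfl

end Product

end SetRegularity

end

theorem mainTheorem7 {X : Type*} [NormedAddCommGroup X] [InnerProductSpace ℝ X] [CompleteSpace X]
    {m : ℕ} (hm : 1 < m) (Ω : Fin m → Set X) (hΩ : ∀ i, IsClosed (Ω i))
    (xbar : X) (hxbar : xbar ∈ ⋂ i, Ω i) :
    (SetRegularity.UniformlyRegular Ω xbar ↔
      0 < SetRegularity.etaHat (SetRegularity.productPair Ω) (SetRegularity.diagPoint m xbar)) ∧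
    (SetRegularity.UniformlyRegular Ω xbar ↔
      SetRegularity.nuHat (SetRegularity.productPair Ω) (SetRegularity.diagPoint m xbar) < 1) ∧
    (SetRegularity.UniformlyRegular Ω xbar ↔
      SetRegularity.cHat (SetRegularity.productPair Ω) (SetRegularity.diagPoint m xbar) < 1) := by
  have hη := SetRegularity.uniformlyRegular_iff_etaHat_pos (zero_lt_one.trans hm) Ω hΩ xbar
  exact ⟨hη, hη.trans (SetRegularity.etaHat_pos_iff_nuHat_lt_one _ _),
    hη.trans (SetRegularity.cHat_lt_one_iff _ _).symm⟩
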